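/- Let $\mu$ be a Radon measure on $\mathbb{R}^n$ (a locally finite Borel measure), let $1\le s<n$ be a real number, and let $B(x,r)$ denote the closed ball with center $x$ and radius $r$. A $(1/s)$-Hölder curve is the image $f([0,1])$ of a map $f:[0,1]\to\mathbb{R}^n$ such that, for some $C<\infty$, $|f(a)-f(b)|\le C|a-b|^{1/s}$ for all $a,b\in[0,1]$. A measure $\nu$ is carried by a family $\mathcal{N}$ of sets if there are countably many $\Gamma_1,\Gamma_2,\ldots\in\mathcal{N}$ with $\nu(\mathbb{R}^n\setminus\bigcup_i\Gamma_i)=0$, and is singular to $\mathcal{N}$ if $\nu(\Gamma)=0$ for every $\Gamma\in\mathcal{N}$. Write $\mu\llcorner E$ for the restriction $F\mapsto\mu(E\cap F)$. (1) The measure $$\underline{\mu}^s_0:=\mu\llcorner\left\{x\in\mathbb{R}^n:\liminf_{r\downarrow0}\frac{\mu(B(x,r))}{r^s}=0\right\}$$ is singular to $(1/s)$-Hölder curves. (2) The measure $$\underline{\mu}^s_\infty:=\mu\llcorner\left\{x\in\mathbb{R}^n:\int_0^1\frac{r^s}{\mu(B(x,r))}\,\frac{dr}{r}<\infty\ \text{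 and }\ \limsup_{r\downarrow0}\frac{\mu(B(x,2r))}{\mu(B(x,r))}<\infty\right\}$$ is carried by $(1/s)$-Hölder curves (the integrand is taken to be $\infty$ when $\mu(B(x,r))=0$). (3) Moreover, there exist countably many $(1/s)$-Hölder curves $\Gamma_i\subseteq\mathbb{R}^n$ and compact sets $K_i\subseteq\Gamma_i$ with $\mathcal{H}^s(K_i)=0$, where $\mathcal{H}^s$ is the $s$-dimensional Hausdorff measure, such that $\underline{\mu}^s_\infty(\mathbb{R}^n\setminus\bigcup_iK_i)=0$. -/

import Mathlib

open Set Filter Topology MeasureTheory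
open scoped NNReal ENNReal

/-- The `(1/s)`-Hölder curves in `X`: the images of maps `f : [0,1] → X` that are
Hölder continuous with exponent `1/s`. -/
def holderCurves (X : Type*) [PseudoEMetricSpace X] (s : ℝ) : Set (Set X) :=
  {Γ | ∃ (f : ℝ → X) (C : ℝ≥0),
    HolderOnWith C (Real.toNNReal (1 / s)) f (Icc 0 1) ∧ f '' Icc 0 1 = Γ}

/-- `μ` is carried by the family `𝒩`: countably many members of `𝒩` cover `μ`-almost everything. -/
def CarriedBy {X : Type*} [MeasurableSpace X] (μ : Measure X) (𝒩 : Set (Set X)) : Prop :=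
  ∃ Γ : ℕ → Set X, (∀ i, Γ i ∈ 𝒩) ∧ μ (⋃ i, Γ i)ᶜ = 0

/-- `μ` is singular to the family `𝒩`: every member of `𝒩` is `μ`-null. -/
def SingularTo {X : Type*} [MeasurableSpace X] (μ : Measure X) (𝒩 : Set (Set X)) : Prop :=
  ∀ Γ ∈ 𝒩, μ Γ = 0

/-- The lower `s`-density `liminf_{r ↓ 0} μ(B(x,r)) / r^s`, with closed balls. -/
noncomputable def lowerDensity {X : Type*} [PseudoMetricSpace X] [MeasurableSpace X]
    (μ : Measure X) (s : ℝ) (x : X) : ℝ≥0∞ :=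
  liminf (fun r : ℝ => μ (Metric.closedBall x r) / ENNReal.ofReal (r ^ s)) (𝓝[>] 0)

/-- The Dini-type integral `∫₀¹ r^s / μ(B(x,r)) dr/r ∈ [0,∞]`, with closed balls. The integrand
is `∞` at the radii `r` with `μ(B(x,r)) = 0`. -/
noncomputable def diniIntegral {X : Type*} [PseudoMetricSpace X] [MeasurableSpace X]
    (μ : Measure X) (s : ℝ) (x : X) : ℝ≥0∞ :=
  ∫⁻ r in Ioc (0 : ℝ) 1,
    ENNReal.ofReal (r ^ s) / μ (Metric.closedBall x r) / ENNReal.ofReal r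

/-- `μ` is asymptotically doubling at `x`:
`limsup_{r ↓ 0} μ(B(x,2r)) / μ(B(x,r)) < ∞`, with closed balls. -/
def AsymptoticallyDoublingAt {X : Type*} [PseudoMetricSpace X] [MeasurableSpace X]
    (μ : Measure X) (x : X) : Prop :=
  limsup (fun r : ℝ => μ (Metric.closedBall x (2 * r)) / μ (Metric.closedBall x r)) (𝓝[>] 0) < ∞

/-!
The singular part is a covering argument on the parameter interval. If the lower density of `μ`
vanishes at `f t`, there are arbitrarily short intervals around `t` whose `f`-image lies in a ball
of radius `r` with `μ`-measure at most `ε r ^ s`, which is `ε` times the length of the interval up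
to a constant. A Besicovitch covering of the parameters by such intervals shows that these points
form a `μ`-null subset of the curve (`singularTo_holderCurves`).

For the carried part it suffices to cover almost every point by countably many compact `ℋˢ`-null
subsets of Hölder curves. The mechanism is a geometric criterion: if the dyadic cubes of a set `E`
satisfy `∑ₖ 2⁻ᵏˢ #{cubes of side 2⁻ᵏ meeting E} < ∞`, then the closure of `E` is `ℋˢ`-null, by
covering it with the cubes of one late generation, and lies on a `(1/s)`-Hölder curve. No curve is
built by hand for this. Ordering the nested cubes lexicographically, each point `x ∈ E` receives as
parameter the total weight `2⁻ᵏˢ` of all cubes before it (`exists_real_separating_of_nested`). Two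
points first separated in generation `k` have parameters at least `2⁻ᵏˢ` apart while their distance
is at most a multiple of `2⁻ᵏ`. So the inverse of the parametrisation is `(1/s)`-Hölder, and it
extends to the interval by McShane's theorem on the snowflaked line
(`exists_holderCurve_closure_subset`).

The measure enters through the count of cubes. Let `A` be a bounded set on which
`∑ₖ 2⁻ᵏˢ / μ(B(x, 2⁻ᵏ)) ≤ M`. Near a density point `v` of `A` at which `μ` is doubling,
`μ(B(v, 2⁻ᵏ⁺¹)) ≤ C μ(A ∩ B(v, 2⁻ᵏ))`, and every `x ∈ B(v, 2⁻ᵏ)` has `B(x, 2⁻ᵏ) ⊆ B(v, 2⁻ᵏ⁺¹)`. Hence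
a cube containing such a point contributes at least `2⁻ᵏˢ / C` to the integral of
`2⁻ᵏˢ / μ(B(x, 2⁻ᵏ))` over `A`, and the sum over cubes and generations is at most `3ⁿ C M μ(A)`
(`mul_card_dyadicIndex_le`, `closure_mem_of_dini_of_density`).
-/

/-! ### Lower density zero -/

/-- Where the lower density of `μ` vanishes, `f` maps suitable arbitrarily short intervals of length
`δ` into balls of measure at most a constant times `ε * δ`. By the Besicovitch
theorem on the line such intervals cover the relevant parameters with total length at most `2`; no doubling of `μ` is needed. -/
theorem singularTo_holderCurves {X : Type*} [MetricSpace X] [MeasurableSpace X] [BorelSpace X]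
    (μ : Measure X) {s : ℝ} (hs : 1 ≤ s) :
    SingularTo (μ.restrict {x | lowerDensity μ s x = 0}) (holderCurves X s) := by
  have hs0 : 0 < s := by linarith
  have hr : ((Real.toNNReal (1 / s) : ℝ≥0) : ℝ) = 1 / s := Real.coe_toNNReal _ (by positivity)
  rintro _ ⟨f, C, hf, rfl⟩
  have hΓ : IsCompact (f '' Icc 0 1) := isCompact_Icc.image_of_continuousOn
    (hf.continuousOn (by simpa using hs0))
  rw [Measure.restrict_apply hΓ.measurableSet]
  -- Any positive Hölder constant `c ≥ C` will do; `C + 1` avoids the constant curves.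
  set c : ℝ := C + 1 with hc
  have hc0 : 0 < c := by positivity
  set D : Set X := {x | lowerDensity μ s x = 0} with hD
  suffices H : ∀ ε : ℝ≥0, 0 < ε → μ (f '' Icc 0 1 ∩ D) ≤ ENNReal.ofReal (c ^ s * 2) * ε by
    have hlim : Tendsto (fun ε : ℝ≥0 => ENNReal.ofReal (c ^ s * 2) * ε) (𝓝[>] 0)
        (𝓝 (ENNReal.ofReal (c ^ s * 2) * (0 : ℝ≥0))) :=
      (ENNReal.Tendsto.const_mul (ENNReal.tendsto_coe.2 tendsto_id)
        (.inr ENNReal.ofReal_ne_top)).mono_left nhdsWithin_le_nhds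
    have := ge_of_tendsto hlim (eventually_mem_nhdsWithin.mono H)
    simpa using this
  intro ε hε
  -- `c * δ ^ (1 / s)` bounds the displacement of `f` over the parameters within `δ` of `t`.
  let F : ℝ → Set ℝ := fun t => {δ | 0 < δ ∧
    μ (Metric.closedBall (f t) (c * δ ^ (1 / s))) ≤ ε * ENNReal.ofReal (c ^ s * δ)}
  have hF : ∀ t ∈ Icc 0 1 ∩ f ⁻¹' D, ∀ η > 0, (F t ∩ Ioo 0 η).Nonempty := by
    rintro t ⟨-, ht⟩ η hη
    have h1 : ∃ᶠ r in 𝓝[>] (0 : ℝ),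
        μ (Metric.closedBall (f t) r) / ENNReal.ofReal (r ^ s) < ε :=
      frequently_lt_of_liminf_lt (by isBoundedDefault)
        (lt_of_eq_of_lt ht (by exact_mod_cast hε))
    have h2 : ∀ᶠ r in 𝓝[>] (0 : ℝ), r ∈ Ioo 0 (c * η ^ (1 / s)) :=
      Ioo_mem_nhdsGT (by positivity)
    obtain ⟨r, hr1, hr0, hrη⟩ := (h1.and_eventually h2).exists
    have hδ : c * ((r / c) ^ s) ^ (1 / s) = r := by
      rw [← Real.rpow_mul (by positivity), mul_one_div_cancel hs0.ne', Real.rpow_one,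
        mul_div_cancel₀ _ hc0.ne']
    -- A small radius `r` is the displacement over time `(r / c) ^ s`.
    refine ⟨(r / c) ^ s, ⟨by positivity, ?_⟩, by positivity, ?_⟩
    · rw [hδ, ← Real.mul_rpow hc0.le (by positivity), mul_div_cancel₀ _ hc0.ne']
      exact ENNReal.div_le_iff_le_mul (.inl (by simp; positivity)) (.inl ENNReal.ofReal_ne_top)
        |>.1 hr1.le
    · rw [← Real.rpow_lt_rpow_iff (by positivity) hη.le (z := 1 / s) (by positivity)]
      rw [← mul_lt_mul_iff_right₀ hc0, hδ]
      exact hrη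
  obtain ⟨t, r, htc, hts, htr, hcov, hsum⟩ := Besicovitch.exists_closedBall_covering_tsum_measure_le
    volume one_ne_zero F (Icc 0 1 ∩ f ⁻¹' D) hF
  have hsub : f '' Icc 0 1 ∩ D ⊆
      ⋃ x ∈ t, Metric.closedBall (f x) (c * r x ^ (1 / s)) := by
    rintro _ ⟨⟨y, hy, rfl⟩, hyD⟩
    obtain ⟨x, hx, hyx⟩ := mem_iUnion₂.1 (hcov ⟨hy, hyD⟩)
    refine mem_iUnion₂.2 ⟨x, hx, ?_⟩
    have := hf.dist_le_of_le hy (hts hx).1 (Metric.mem_closedBall.1 hyx)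
    rw [hr] at this
    refine Metric.mem_closedBall.2 (this.trans ?_)
    have := (htr x hx).1
    gcongr
    linarith
  calc μ (f '' Icc 0 1 ∩ D) ≤ ∑' x : t, μ (Metric.closedBall (f x) (c * r x ^ (1 / s))) :=
        (measure_mono hsub).trans (measure_biUnion_le μ htc _)
    _ ≤ ∑' x : t, ENNReal.ofReal (c ^ s) * ε * volume (Metric.closedBall (x : ℝ) (r x)) := by
        refine ENNReal.tsum_le_tsum fun x => (htr x x.2).2.trans ?_
        have := (htr x x.2).1
        rw [Real.volume_closedBall, ENNReal.ofReal_mul (by positivity),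
          mul_left_comm, mul_assoc, mul_comm (ε : ℝ≥0∞), mul_comm (ε : ℝ≥0∞)]
        gcongr
        linarith
    _ ≤ ENNReal.ofReal (c ^ s) * ε * 2 := by
        rw [ENNReal.tsum_mul_left]
        gcongr
        refine hsum.trans ?_
        calc volume (Icc (0:ℝ) 1 ∩ f ⁻¹' D) + 1 ≤ volume (Icc (0:ℝ) 1) + 1 := by
              gcongr
              exact inter_subset_left
          _ = 2 := by simp [one_add_one_eq_two]
    _ = ENNReal.ofReal (c ^ s * 2) * ε := by
        rw [ENNReal.ofReal_mul (by positivity)]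
        simp only [ENNReal.ofReal_ofNat]
        ring

/-! ### Hölder curves through a parametrised set -/

/-- Hölder maps into a finite-dimensional space extend, because an `r`-Hölder map is a Lipschitz map
on the `r`-snowflake of its domain. -/
theorem HolderOnWith.exists_holderWith_extend {V : Type*} [NormedAddCommGroup V]
    [NormedSpace ℝ V] [FiniteDimensional ℝ V] {Y : Type*} [PseudoMetricSpace Y]
    {f : Y → V} {S : Set Y} {C r : ℝ≥0}
    (hr0 : 0 < (r : ℝ)) (hr1 : (r : ℝ) ≤ 1) (hf : HolderOnWith C r f S) :
    ∃ (C' : ℝ≥0) (g : Y → V), HolderWith C' r g ∧ EqOn f g S := by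
  let e : Metric.Snowflaking Y (r : ℝ) hr0 hr1 ≃ Y := Metric.Snowflaking.ofSnowflaking
  have h : LipschitzOnWith C (f ∘ e) (e ⁻¹' S) := by
    intro x hx y hy
    have := hf (e x) hx (e y) hy
    rwa [← Metric.Snowflaking.edist_def] at this
  obtain ⟨g, hg, hfg⟩ := h.extend_finite_dimension
  refine ⟨lipschitzExtensionConstant V * C, g ∘ e.symm, fun x y => ?_, fun x hx => ?_⟩
  · have := hg (e.symm x) (e.symm y)
    rwa [Metric.Snowflaking.edist_def] at this
  · simpa using hfg (x := e.symm x) (by simpa using hx)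

/-- A set lies on a `(1/s)`-Hölder curve as soon as its points can be given real parameters whose
mutual distances dominate `dist x y ^ s`: the inverse of the parametrisation is Hölder on the set of
parameters, and its extension has compact image, so even the closure is covered. -/
theorem exists_holderCurve_closure_subset {V : Type*} [NormedAddCommGroup V]
    [NormedSpace ℝ V] [FiniteDimensional ℝ V] {s : ℝ} (hs : 1 ≤ s) {E : Set V} {t : V → ℝ}
    {T D : ℝ} (ht : MapsTo t E (Icc 0 T)) (hD : 0 ≤ D)
    (h : ∀ x ∈ E, ∀ y ∈ E, dist x y ≤ D * |t x - t y| ^ (1 / s)) :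
    ∃ Γ ∈ holderCurves V s, closure E ⊆ Γ := by
  have hs0 : 0 < s := by linarith
  have hr : ((Real.toNNReal (1 / s) : ℝ≥0) : ℝ) = 1 / s := Real.coe_toNNReal _ (by positivity)
  rcases E.eq_empty_or_nonempty with rfl | ⟨x₀, hx₀⟩
  · exact ⟨_, ⟨fun _ => 0, 0, HolderWith.const.holderOnWith _, rfl⟩, by simp⟩
  have hinj : InjOn t E := by
    intro x hx y hy hxy
    have := h x hx y hy
    rw [hxy, sub_self, abs_zero, Real.zero_rpow (by positivity), mul_zero] at this
    exact dist_le_zero.1 this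
  -- The curve is parametrised on `[0, 1]` through `u = t / R`.
  set R : ℝ := max T 1 with hR
  have hR0 : 0 < R := by positivity
  have hleft : ∀ x ∈ E, Function.invFunOn t E (R * (t x / R)) = x := by
    intro x hx
    rw [mul_div_cancel₀ _ hR0.ne']
    exact hinj.leftInvOn_invFunOn hx
  have hhol : HolderOnWith (Real.toNNReal (D * R ^ (1 / s))) (Real.toNNReal (1 / s))
      (fun u => Function.invFunOn t E (R * u)) ((fun x => t x / R) '' E) := by
    rintro _ ⟨x, hx, rfl⟩ _ ⟨y, hy, rfl⟩
    simp only [hleft x hx, hleft y hy]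
    rw [hr, edist_dist, edist_dist, ENNReal.ofReal_rpow_of_nonneg dist_nonneg (by positivity),
      ← ENNReal.ofReal.eq_1, ← ENNReal.ofReal_mul (by positivity)]
    refine ENNReal.ofReal_le_ofReal ((h x hx y hy).trans_eq ?_)
    rw [mul_assoc, ← Real.mul_rpow hR0.le dist_nonneg, Real.dist_eq, ← sub_div, abs_div,
      abs_of_pos hR0, mul_div_cancel₀ _ hR0.ne']
  obtain ⟨C, g, hg, hEq⟩ := hhol.exists_holderWith_extend
    (by rw [hr]; positivity) (by rw [hr]; simpa using inv_le_one_of_one_le₀ hs)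
  refine ⟨_, ⟨g, C, hg.holderOnWith _, rfl⟩, ?_⟩
  refine closure_minimal (fun x hx => ⟨t x / R, ?_, ?_⟩)
    (isCompact_Icc.image (hg.continuous (by simpa using hs0))).isClosed
  · have := ht hx
    exact ⟨div_nonneg this.1 hR0.le, (div_le_one hR0).2 (this.2.trans (le_max_left _ _))⟩
  · rw [← hEq ⟨x, hx, rfl⟩]
    exact hleft x hx

/-! ### Parameters from nested partitions -/

/-- Let `d 0, d 1, …` label the cells of successively finer finite partitions of `α`, with weights
`w k` such that the total weight `∑ w k * #cells` is finite. Then the points of `α` can be placed in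
a bounded interval so that points in different cells of generation `k` are at least `w k` apart.
The position of `x` is the total weight of the cells that precede the cell of `x` in the
lexicographic order of label sequences. -/
theorem exists_real_separating_of_nested {α : Type*} {d : ℕ → α → ℕ}
    (hd : ∀ k x y, d (k + 1) x = d (k + 1) y → d k x = d k y)
    (hfin : ∀ k, (range (d k)).Finite) {w : ℕ → ℝ} (hw : ∀ k, 0 ≤ w k)
    (hsum : Summable fun k => w k * (range (d k)).ncard) :
    ∃ (t : α → ℝ) (T : ℝ), (∀ x, t x ∈ Icc 0 T) ∧
      ∀ x y k, d k x ≠ d k y → w k ≤ |t x - t y| := by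
  have hd' : ∀ j k, j ≤ k → ∀ x y, d k x = d k y → d j x = d j y := by
    intro j k hjk x y
    induction k, hjk using Nat.le_induction with
    | base => exact id
    | succ k _ ih => exact fun h => ih (hd k x y h)
  let u : α → Lex (ℕ → ℕ) := fun x => toLex fun k => d k x
  have hu : ∀ x y, u x < u y ↔ ∃ i, (∀ j < i, d j x = d j y) ∧ d i x < d i y := fun x y => Iff.rfl
  -- `L k x` is the set of cells of generation `k` that precede the cell of `x`.
  let L : ℕ → α → Set ℕ := fun k x => {c | c ≠ d k x ∧ ∃ z, u z < u x ∧ d k z = c}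
  have hLr : ∀ k x, L k x ⊆ range (d k) := fun k x c hc => by
    obtain ⟨-, z, -, hz⟩ := hc
    exact ⟨z, hz⟩
  have hLf : ∀ k x, (L k x).Finite := fun k x => (hfin k).subset (hLr k x)
  have hle : ∀ k x, w k * (L k x).ncard ≤ w k * (range (d k)).ncard := fun k x =>
    mul_le_mul_of_nonneg_left (mod_cast ncard_le_ncard (hLr k x) (hfin k)) (hw k)
  have h0 : ∀ k x, 0 ≤ w k * (L k x).ncard := fun k x => mul_nonneg (hw k) (by positivity)
  have hs : ∀ x, Summable fun k => w k * ((L k x).ncard : ℝ) := fun x =>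
    Summable.of_nonneg_of_le (h0 · x) (hle · x) hsum
  -- Cells are order-convex for the lexicographic order, hence `L k` is monotone along it.
  have hmono : ∀ x y, u x < u y → ∀ k, L k x ⊆ L k y := by
    rintro x y hxy k c ⟨hcx, z, hzx, rfl⟩
    refine ⟨fun hzy => hcx ?_, z, hzx.trans hxy, rfl⟩
    obtain ⟨i, hi, hi'⟩ := (hu _ _).1 hzx
    obtain ⟨j, hj, hj'⟩ := (hu _ _).1 hxy
    rcases lt_or_ge k i with hki | hik
    · exact hi k hki
    have key := fun m hm => hd' m k hm z y hzy
    rcases lt_trichotomy i j with hij | rfl | hij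
    · have := hj i hij
      have := key i hik
      omega
    · have := key i hik
      omega
    · have := hi j hij
      have := key j (by omega)
      omega
  -- In generation `k` the cell of `x` itself precedes `y` but not `x`.
  have main : ∀ x y k, d k x ≠ d k y → u x < u y →
      w k ≤ (∑' k, w k * ((L k y).ncard : ℝ)) - ∑' k, w k * ((L k x).ncard : ℝ) := by
    intro x y k hk hxy
    rw [← (hs y).tsum_sub (hs x)]
    have hcard : (L k x).ncard + 1 ≤ (L k y).ncard := by
      have hx : d k x ∉ L k x := fun h => h.1 rfl
      rw [← ncard_insert_of_notMem hx (hLf k x)]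
      exact ncard_le_ncard (insert_subset ⟨hk, x, hxy, rfl⟩ (hmono x y hxy k)) (hLf k y)
    have hcard' : ((L k x).ncard : ℝ) + 1 ≤ (L k y).ncard := mod_cast hcard
    refine le_trans ?_ (((hs y).sub (hs x)).le_tsum k fun j _ => ?_)
    · nlinarith [hw k]
    · have : ((L j x).ncard : ℝ) ≤ (L j y).ncard :=
        mod_cast ncard_le_ncard (hmono x y hxy j) (hLf j y)
      nlinarith [hw j]
  refine ⟨fun x => ∑' k, w k * ((L k x).ncard : ℝ), ∑' k, w k * ((range (d k)).ncard : ℝ),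
    fun x => ⟨tsum_nonneg (h0 · x), (hs x).tsum_le_tsum (hle · x) hsum⟩, fun x y k hk => ?_⟩
  rcases lt_trichotomy (u x) (u y) with h | h | h
  · rw [abs_sub_comm]
    exact (main x y k hk h).trans (le_abs_self _)
  · exact absurd (congrFun (congrArg ofLex h) k) hk
  · exact (main y x k hk.symm h).trans (le_abs_self _)

/-! ### Dyadic cubes -/

/-- The index of the half-open dyadic cube of side `2⁻ᵏ` that contains `x`. -/
noncomputable def dyadicIndex {n : ℕ} (k : ℕ) (x : EuclideanSpace ℝ (Fin n)) : Fin n → ℤ :=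
  fun i => ⌊(2 : ℝ) ^ k * x i⌋

theorem dyadicIndex_eq_of_succ {n k : ℕ} {x y : EuclideanSpace ℝ (Fin n)}
    (h : dyadicIndex (k + 1) x = dyadicIndex (k + 1) y) : dyadicIndex k x = dyadicIndex k y := by
  have key : ∀ a : ℝ, 2 * ⌊(2 : ℝ) ^ k * a⌋ < ⌊(2 : ℝ) ^ (k + 1) * a⌋ + 1 ∧
      ⌊(2 : ℝ) ^ (k + 1) * a⌋ < 2 * ⌊(2 : ℝ) ^ k * a⌋ + 2 := by
    intro a
    have h1 := Int.floor_le ((2 : ℝ) ^ k * a)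
    have h2 := Int.lt_floor_add_one ((2 : ℝ) ^ k * a)
    have h3 := Int.floor_le ((2 : ℝ) ^ (k + 1) * a)
    have h4 := Int.lt_floor_add_one ((2 : ℝ) ^ (k + 1) * a)
    have h5 : (2 : ℝ) ^ (k + 1) * a = 2 * (2 ^ k * a) := by ring
    rify
    constructor <;> linarith
  funext i
  have hi : ⌊(2 : ℝ) ^ (k + 1) * x i⌋ = ⌊(2 : ℝ) ^ (k + 1) * y i⌋ := congrFun h i
  have hx := key (x i)
  have hy := key (y i)
  show ⌊(2 : ℝ) ^ k * x i⌋ = ⌊(2 : ℝ) ^ k * y i⌋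
  omega

theorem dist_le_of_dyadicIndex_eq {n k : ℕ} {x y : EuclideanSpace ℝ (Fin n)}
    (h : dyadicIndex k x = dyadicIndex k y) : dist x y ≤ √n * (1 / 2) ^ k := by
  rw [EuclideanSpace.dist_eq]
  refine Real.sqrt_le_iff.2 ⟨by positivity, ?_⟩
  have hi : ∀ i ∈ Finset.univ, dist (x i) (y i) ^ 2 ≤ ((1 / 2 : ℝ) ^ k) ^ 2 := by
    intro i _
    have h1 : |(2 : ℝ) ^ k * x i - 2 ^ k * y i| < 1 :=
      Int.abs_sub_lt_one_of_floor_eq_floor (congrFun h i)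
    rw [← mul_sub, abs_mul, abs_of_pos (by positivity)] at h1
    refine pow_le_pow_left₀ dist_nonneg ?_ 2
    rw [Real.dist_eq, one_div, inv_pow, ← one_div, le_div_iff₀' (by positivity)]
    exact h1.le
  refine (Finset.sum_le_card_nsmul _ _ _ hi).trans_eq ?_
  rw [Finset.card_univ, Fintype.card_fin, nsmul_eq_mul, mul_pow, Real.sq_sqrt (by positivity)]

/-- A ball of radius `2⁻ᵏ` meets at most `3ⁿ` dyadic cubes of side `2⁻ᵏ`. -/
theorem card_le_of_forall_dyadicIndex_near {n k : ℕ} (x : EuclideanSpace ℝ (Fin n))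
    (F : Finset (Fin n → ℤ))
    (hF : ∀ q ∈ F, ∃ v, dyadicIndex k v = q ∧ dist x v ≤ (1 / 2) ^ k) : F.card ≤ 3 ^ n := by
  have hsub : F ⊆ Fintype.piFinset fun i =>
      Finset.Icc (dyadicIndex k x i - 1) (dyadicIndex k x i + 1) := by
    intro q hq
    obtain ⟨v, rfl, hv⟩ := hF q hq
    refine Fintype.mem_piFinset.2 fun i => Finset.mem_Icc.2 ?_
    have h1 : |x i - v i| ≤ (1 / 2) ^ k := by
      rw [← Real.dist_eq]
      refine le_trans ?_ hv
      rw [dist_eq_norm, dist_eq_norm]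
      exact PiLp.norm_apply_le (x - v) i
    have h2 : |(2 : ℝ) ^ k * x i - 2 ^ k * v i| ≤ 1 := by
      rw [← mul_sub, abs_mul, abs_of_pos (by positivity)]
      calc (2 : ℝ) ^ k * |x i - v i| ≤ 2 ^ k * (1 / 2) ^ k := by gcongr
        _ = 1 := by rw [← mul_pow]; norm_num
    have h3 := Int.floor_le ((2 : ℝ) ^ k * x i)
    have h4 := Int.lt_floor_add_one ((2 : ℝ) ^ k * x i)
    have h5 := Int.floor_le ((2 : ℝ) ^ k * v i)
    have h6 := Int.lt_floor_add_one ((2 : ℝ) ^ k * v i)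
    obtain ⟨h7, h8⟩ := abs_le.1 h2
    have h9 : ⌊(2 : ℝ) ^ k * x i⌋ < ⌊(2 : ℝ) ^ k * v i⌋ + 2 := by rify; linarith
    have h10 : ⌊(2 : ℝ) ^ k * v i⌋ < ⌊(2 : ℝ) ^ k * x i⌋ + 2 := by rify; linarith
    show ⌊(2 : ℝ) ^ k * x i⌋ - 1 ≤ ⌊(2 : ℝ) ^ k * v i⌋ ∧
      ⌊(2 : ℝ) ^ k * v i⌋ ≤ ⌊(2 : ℝ) ^ k * x i⌋ + 1
    omega
  refine (Finset.card_le_card hsub).trans_eq ?_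
  have : ∀ a : ℤ, (a + 1 + 1 - (a - 1)).toNat = 3 := fun a => by omega
  simp [Fintype.card_piFinset, this]

theorem tendsto_mul_half_pow_add (c : ℝ) (m : ℕ) :
    Tendsto (fun j : ℕ => c * (1 / 2 : ℝ) ^ (m + j)) atTop (𝓝 0) := by
  have := ((tendsto_pow_atTop_nhds_zero_of_lt_one (r := (1 / 2 : ℝ)) (by norm_num)
    (by norm_num)).comp ((tendsto_add_atTop_nat m).congr fun j => add_comm _ _)).const_mul c
  simpa using this

/-- The cubes of generation `m + j` that meet `E` are the cells to which
`exists_real_separating_of_nested` is applied, with weights `2^{-(m + j)s}`. -/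
theorem exists_holderCurve_of_summable_dyadic {n : ℕ} {s : ℝ} (hs : 1 ≤ s) {m : ℕ}
    {E : Set (EuclideanSpace ℝ (Fin n))}
    (hE : ∀ x ∈ E, ∀ y ∈ E, dyadicIndex m x = dyadicIndex m y)
    (hfin : ∀ j, (dyadicIndex (m + j) '' E).Finite)
    (hsum : Summable fun j => ((1 / 2 : ℝ) ^ (m + j)) ^ s * (dyadicIndex (m + j) '' E).ncard) :
    ∃ Γ ∈ holderCurves (EuclideanSpace ℝ (Fin n)) s, closure E ⊆ Γ := by
  have hs0 : 0 < s := by linarith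
  let d : ℕ → E → ℕ := fun j x => Encodable.encode (dyadicIndex (m + j) x.1)
  have hd : ∀ j (x y : E),
      d j x = d j y ↔ dyadicIndex (m + j) x.1 = dyadicIndex (m + j) y.1 :=
    fun j x y => Encodable.encode_injective.eq_iff
  have hrange : ∀ j, range (d j) = Encodable.encode '' (dyadicIndex (m + j) '' E) := by
    intro j
    ext c
    simp [d]
  obtain ⟨t, T, ht, hsep⟩ := exists_real_separating_of_nested (d := d)
    (fun j x y h => (hd _ _ _).2 (dyadicIndex_eq_of_succ ((hd _ _ _).1 h)))
    (fun j => by rw [hrange]; exact (hfin j).image _)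
    (w := fun j => ((1 / 2 : ℝ) ^ (m + j)) ^ s) (fun j => by positivity)
    (by
      simp only [hrange]
      simpa only [ncard_image_of_injective _ Encodable.encode_injective] using hsum)
  classical
  refine exists_holderCurve_closure_subset hs (E := E)
    (t := fun x => if h : x ∈ E then t ⟨x, h⟩ else 0) (T := T) (D := 2 * √n)
    (fun x hx => by simpa [hx] using ht ⟨x, hx⟩) (by positivity) fun x hx y hy => ?_
  simp only [hx, hy, dif_pos]
  by_cases hxy : ∀ j, d j ⟨x, hx⟩ = d j ⟨y, hy⟩
  · refine (ge_of_tendsto' (tendsto_mul_half_pow_add (√n) m) fun j =>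
      dist_le_of_dyadicIndex_eq ((hd _ _ _).1 (hxy j))).trans (by positivity)
  · push Not at hxy
    -- `x` and `y` share a cube up to the generation before the first one that separates them.
    obtain ⟨i, hi⟩ : ∃ i, Nat.find hxy = i + 1 := Nat.exists_eq_succ_of_ne_zero fun h0 =>
      Nat.find_spec hxy ((hd _ _ _).2 (by rw [h0]; exact hE x hx y hy))
    have hsame : d i ⟨x, hx⟩ = d i ⟨y, hy⟩ := by
      have := Nat.find_min hxy (m := i) (by omega)
      exact not_not.1 this
    have hw := hsep _ _ _ (Nat.find_spec hxy)
    rw [hi] at hw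
    calc dist x y ≤ √n * (1 / 2) ^ (m + i) := dist_le_of_dyadicIndex_eq ((hd _ _ _).1 hsame)
      _ = 2 * √n * (((1 / 2 : ℝ) ^ (m + (i + 1))) ^ s) ^ (1 / s) := by
          rw [← Real.rpow_mul (by positivity), mul_one_div_cancel hs0.ne', Real.rpow_one]
          ring
      _ ≤ _ := by gcongr

theorem hausdorffMeasure_closure_eq_zero_of_summable_dyadic {n : ℕ} {s : ℝ} (hs : 0 < s) {m : ℕ}
    {E : Set (EuclideanSpace ℝ (Fin n))}
    (hfin : ∀ j, (dyadicIndex (m + j) '' E).Finite)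
    (hsum : Summable fun j => ((1 / 2 : ℝ) ^ (m + j)) ^ s * (dyadicIndex (m + j) '' E).ncard) :
    Measure.hausdorffMeasure s (closure E) = 0 := by
  let _ : ∀ j, Fintype (dyadicIndex (m + j) '' E) := fun j => (hfin j).fintype
  have hdiam : ∀ j (q : dyadicIndex (m + j) '' E),
      Metric.ediam (closure (E ∩ dyadicIndex (m + j) ⁻¹' {q.1})) ≤
        ENNReal.ofReal (√n * (1 / 2) ^ (m + j)) := by
    intro j q
    rw [Metric.ediam_closure]
    refine Metric.ediam_le fun x hx y hy => ?_
    rw [edist_dist]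
    exact ENNReal.ofReal_le_ofReal (dist_le_of_dyadicIndex_eq (hx.2.trans hy.2.symm))
  have hcover : ∀ j, closure E ⊆
      ⋃ q : dyadicIndex (m + j) '' E, closure (E ∩ dyadicIndex (m + j) ⁻¹' {q.1}) := by
    intro j
    rw [← closure_iUnion_of_finite]
    exact closure_mono fun x hx => mem_iUnion.2 ⟨⟨_, x, hx, rfl⟩, hx, rfl⟩
  have hle := Measure.hausdorffMeasure_le_liminf_sum s (closure E) (l := atTop)
    (fun j => ENNReal.ofReal (√n * (1 / 2) ^ (m + j)))
    (by simpa using ENNReal.tendsto_ofReal (tendsto_mul_half_pow_add (√n) m))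
    (fun j (q : dyadicIndex (m + j) '' E) => closure (E ∩ dyadicIndex (m + j) ⁻¹' {q.1}))
    (.of_forall hdiam) (.of_forall hcover)
  have hlim : Tendsto (fun j => ENNReal.ofReal (√n ^ s *
      (((1 / 2 : ℝ) ^ (m + j)) ^ s * (dyadicIndex (m + j) '' E).ncard))) atTop (𝓝 0) := by
    simpa using ENNReal.tendsto_ofReal (hsum.tendsto_atTop_zero.const_mul (√n ^ s))
  refine le_antisymm (hle.trans ((liminf_le_liminf (.of_forall fun j => ?_)).trans_eq
    hlim.liminf_eq)) bot_le
  refine (Finset.sum_le_card_nsmul _ _ _ fun q _ =>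
    ENNReal.rpow_le_rpow (hdiam j q) hs.le).trans_eq ?_
  rw [ENNReal.ofReal_rpow_of_nonneg (by positivity) hs.le, nsmul_eq_mul, Finset.card_univ,
    ← Nat.card_eq_fintype_card, Nat.card_coe_set_eq, ← ENNReal.ofReal_natCast,
    ← ENNReal.ofReal_mul (by positivity), Real.mul_rpow (by positivity) (by positivity)]
  congr 1
  ring

/-! ### Counting cubes by the measure -/

theorem measurable_measure_closedBall {X : Type*} [PseudoMetricSpace X]
    [SecondCountableTopology X] [MeasurableSpace X] [OpensMeasurableSpace X] (μ : Measure X)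
    [SFinite μ] (r : ℝ) : Measurable fun x => μ (Metric.closedBall x r) := by
  have h : MeasurableSet {p : X × X | dist p.2 p.1 ≤ r} :=
    (isClosed_le (by fun_prop) (by fun_prop)).measurableSet
  exact measurable_measure_prodMk_left h

/-- The term of generation `k` of the dyadic sum `∑ₖ 2⁻ᵏˢ / μ(B(x, 2⁻ᵏ))` that discretises
`diniIntegral μ s x`. -/
noncomputable def diniTerm {X : Type*} [PseudoMetricSpace X] [MeasurableSpace X]
    (μ : Measure X) (s : ℝ) (k : ℕ) (x : X) : ℝ≥0∞ :=
  ENNReal.ofReal (((1 / 2 : ℝ) ^ k) ^ s) / μ (Metric.closedBall x ((1 / 2) ^ k))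

/-- On `2⁻ᵏ⁻¹ < r ≤ 2⁻ᵏ` the integrand of `diniIntegral` is bounded below by a constant
comparable to `2ᵏ * diniTerm μ s k x`. -/
theorem tsum_diniTerm_ne_top {X : Type*} [PseudoMetricSpace X] [MeasurableSpace X]
    {μ : Measure X} {s : ℝ} (hs : 0 < s) {x : X} (h : diniIntegral μ s x < ∞) :
    ∑' k, diniTerm μ s k x ≠ ∞ := by
  let f : ℕ → ℝ := fun k => (1 / 2) ^ k
  have hf : Antitone f := pow_right_anti₀ (by norm_num) (by norm_num)
  have hpos : ∀ k, 0 < f k := fun k => by positivity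
  have hhalf : ∀ k, f (k + 1) = 1 / 2 * f k := fun k => pow_succ' _ _
  have hterm : ∀ k, ENNReal.ofReal ((1 / 2) ^ s * (1 / 2)) * diniTerm μ s k x ≤
      ∫⁻ r in Ioc (f (k + 1)) (f k),
        ENNReal.ofReal (r ^ s) / μ (Metric.closedBall x r) / ENNReal.ofReal r := by
    intro k
    calc ENNReal.ofReal ((1 / 2) ^ s * (1 / 2)) * diniTerm μ s k x
        = ENNReal.ofReal (f (k + 1) ^ s) / μ (Metric.closedBall x (f k)) /
            ENNReal.ofReal (f k) * volume (Ioc (f (k + 1)) (f k)) := by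
          have h1 : f k - f (k + 1) = 1 / 2 * f k := by rw [hhalf]; ring
          have h2 : ENNReal.ofReal (f k) ≠ 0 := by simpa using hpos k
          rw [Real.volume_Ioc, h1, hhalf, Real.mul_rpow (by norm_num) (hpos k).le,
            ENNReal.ofReal_mul (by positivity), ENNReal.ofReal_mul (by positivity),
            ENNReal.ofReal_mul (by positivity), diniTerm]
          simp only [div_eq_mul_inv]
          have h3 := ENNReal.inv_mul_cancel h2 ENNReal.ofReal_ne_top
          generalize ENNReal.ofReal ((1 * 2⁻¹) ^ s) = a, ENNReal.ofReal (1 * 2⁻¹) = b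
          calc a * b * (ENNReal.ofReal (f k ^ s) * (μ (Metric.closedBall x (f k)))⁻¹)
              = a * b * (ENNReal.ofReal (f k ^ s) * (μ (Metric.closedBall x (f k)))⁻¹) *
                ((ENNReal.ofReal (f k))⁻¹ * ENNReal.ofReal (f k)) := by rw [h3, mul_one]
            _ = _ := by ring
      _ = ∫⁻ _ in Ioc (f (k + 1)) (f k),
            ENNReal.ofReal (f (k + 1) ^ s) / μ (Metric.closedBall x (f k)) /
              ENNReal.ofReal (f k) := by rw [setLIntegral_const]
      _ ≤ _ := by
          refine setLIntegral_mono' measurableSet_Ioc fun r hr => ?_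
          have := hpos (k + 1)
          gcongr
          exacts [hr.1.le, hr.2, hr.2]
  have hsum : ENNReal.ofReal ((1 / 2) ^ s * (1 / 2)) * ∑' k, diniTerm μ s k x ≤
      diniIntegral μ s x := by
    rw [← ENNReal.tsum_mul_left]
    refine (ENNReal.tsum_le_tsum hterm).trans ?_
    refine (lintegral_iUnion (fun _ => measurableSet_Ioc)
      hf.pairwise_disjoint_on_Ioc_succ _).symm.trans_le ?_
    refine lintegral_mono_set (iUnion_subset fun k r hr => ⟨(hpos _).trans hr.1, hr.2.trans ?_⟩)
    exact pow_le_one₀ (by norm_num) (by norm_num)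
  intro htop
  rw [htop, ENNReal.mul_top (by simp; positivity)] at hsum
  exact (hsum.trans_lt h).ne rfl

theorem ENNReal.finite_and_mul_ncard_le {α : Type*} {S : Set α} {c a : ℝ≥0∞} (hc : c ≠ 0)
    (ha : a ≠ ∞) (h : ∀ F : Finset α, ↑F ⊆ S → c * F.card ≤ a) :
    S.Finite ∧ c * S.ncard ≤ a := by
  have hfin : S.Finite := by
    by_contra hS
    obtain ⟨N, hN⟩ := ENNReal.exists_nat_mul_gt hc ha
    obtain ⟨F, hF, hcard⟩ := Set.Infinite.exists_subset_card_eq hS N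
    refine (h F hF).not_gt ?_
    rwa [hcard, mul_comm]
  refine ⟨hfin, ?_⟩
  rw [ncard_eq_toFinset_card S hfin]
  exact h _ (by simp)

section

variable {n : ℕ} {μ : Measure (EuclideanSpace ℝ (Fin n))} [IsLocallyFiniteMeasure μ] {s : ℝ}

theorem measurable_diniTerm (k : ℕ) : Measurable (diniTerm μ s k) :=
  (measurable_measure_closedBall μ _).const_div _

/-- Counting the dyadic cubes of side `2⁻ᵏ` that meet `E` by the measure `μ`: each contains a point
`v` of `E` around which `A` has a definite proportion of the mass, so that the integral of
`diniTerm μ s k` over `A ∩ B(v, 2⁻ᵏ)` is at least `2⁻ᵏˢ / C`; these balls overlap at most `3ⁿ`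
times. -/
theorem mul_card_dyadicIndex_le {A E : Set (EuclideanSpace ℝ (Fin n))} {k : ℕ} {C : ℝ≥0∞}
    (hpos : ∀ v ∈ E, μ (Metric.closedBall v (2 * (1 / 2) ^ k)) ≠ 0)
    (hdens : ∀ v ∈ E, μ (Metric.closedBall v (2 * (1 / 2) ^ k)) ≤
      C * μ (A ∩ Metric.closedBall v ((1 / 2) ^ k)))
    (F : Finset (Fin n → ℤ)) (hF : ↑F ⊆ dyadicIndex k '' E) :
    ENNReal.ofReal (((1 / 2 : ℝ) ^ k) ^ s) * F.card ≤
      C * (3 ^ n * ∫⁻ x in A, diniTerm μ s k x ∂μ) := by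
  classical
  have hF' : ∀ q ∈ F, ∃ v ∈ E, dyadicIndex k v = q := fun q hq => hF hq
  choose! v hvE hv using hF'
  let B : (Fin n → ℤ) → Set (EuclideanSpace ℝ (Fin n)) :=
    fun q => Metric.closedBall (v q) ((1 / 2) ^ k)
  have hB : ∀ q, MeasurableSet (B q) := fun q => measurableSet_closedBall
  have hone : ∀ q ∈ F, ENNReal.ofReal (((1 / 2 : ℝ) ^ k) ^ s) ≤
      C * ∫⁻ x in A, (B q).indicator (diniTerm μ s k) x ∂μ := by
    intro q hq
    set b := μ (Metric.closedBall (v q) (2 * (1 / 2) ^ k)) with hb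
    set w := ENNReal.ofReal (((1 / 2 : ℝ) ^ k) ^ s) with hw
    have hbtop : b ≠ ∞ := measure_closedBall_lt_top.ne
    calc w = w / b * b := (ENNReal.div_mul_cancel (hpos _ (hvE q hq)) hbtop).symm
      _ ≤ w / b * (C * μ (A ∩ B q)) := by gcongr; exact hdens _ (hvE q hq)
      _ = C * ∫⁻ _ in B q, w / b ∂(μ.restrict A) := by
          rw [setLIntegral_const, Measure.restrict_apply (hB q), inter_comm (B q)]
          ring
      _ ≤ C * ∫⁻ x in B q, diniTerm μ s k x ∂(μ.restrict A) := by
          refine mul_le_mul_right ?_ _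
          refine setLIntegral_mono' (hB q) fun x hx => ?_
          refine ENNReal.div_le_div_left (measure_mono ?_) _
          refine Metric.closedBall_subset_closedBall' ?_
          linarith [Metric.mem_closedBall.1 hx]
      _ = _ := by rw [lintegral_indicator (hB q)]
  calc ENNReal.ofReal (((1 / 2 : ℝ) ^ k) ^ s) * F.card
      = ∑ q ∈ F, ENNReal.ofReal (((1 / 2 : ℝ) ^ k) ^ s) := by
        rw [Finset.sum_const, nsmul_eq_mul, mul_comm]
    _ ≤ ∑ q ∈ F, C * ∫⁻ x in A, (B q).indicator (diniTerm μ s k) x ∂μ := Finset.sum_le_sum hone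
    _ = C * ∫⁻ x in A, ∑ q ∈ F, (B q).indicator (diniTerm μ s k) x ∂μ := by
        rw [← Finset.mul_sum, lintegral_finsetSum _ fun q _ =>
          (measurable_diniTerm k).indicator (hB q)]
    _ ≤ C * ∫⁻ x in A, 3 ^ n * diniTerm μ s k x ∂μ := by
        gcongr with x
        simp only [indicator_apply]
        rw [← Finset.sum_filter, Finset.sum_const, nsmul_eq_mul]
        gcongr
        have := card_le_of_forall_dyadicIndex_near (k := k) x {q ∈ F | x ∈ B q} fun q hq => by
          rw [Finset.mem_filter] at hq
          exact ⟨v q, hv q hq.1, Metric.mem_closedBall.1 hq.2⟩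
        exact_mod_cast this
    _ = _ := by rw [lintegral_const_mul _ (measurable_diniTerm k)]

/-- If the dyadic Dini sum is bounded on `A`, and `E ⊆ A` consists of points where, from generation
`m` on, `A` fills a definite proportion of each doubled ball, then the dyadic cubes meeting `E` have
summable `s`-th powers of sides, so the closure of `E` is an `ℋˢ`-null compact subset of a
`(1/s)`-Hölder curve. -/
theorem closure_mem_of_dini_of_density (hs : 1 ≤ s) {A E : Set (EuclideanSpace ℝ (Fin n))}
    {m : ℕ} {M C : ℝ≥0∞} (hA : MeasurableSet A) (hAtop : μ A ≠ ∞) (hM : M ≠ ∞) (hC : C ≠ ∞)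
    (hdini : ∀ x ∈ A, ∑' k, diniTerm μ s k x ≤ M) (hEA : E ⊆ A)
    (hcube : ∀ x ∈ E, ∀ y ∈ E, dyadicIndex m x = dyadicIndex m y)
    (hdens : ∀ k ≥ m, ∀ v ∈ E, μ (Metric.closedBall v (2 * (1 / 2) ^ k)) ≤
      C * μ (A ∩ Metric.closedBall v ((1 / 2) ^ k))) :
    closure E ∈ {K | IsCompact K ∧ Measure.hausdorffMeasure s K = 0 ∧
      ∃ Γ ∈ holderCurves (EuclideanSpace ℝ (Fin n)) s, K ⊆ Γ} := by
  have hs0 : 0 < s := by linarith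
  have hpos : ∀ k, ∀ v ∈ E, μ (Metric.closedBall v (2 * (1 / 2) ^ k)) ≠ 0 := by
    intro k v hv h0
    have h1 : μ (Metric.closedBall v ((1 / 2) ^ k)) = 0 :=
      measure_mono_null (Metric.closedBall_subset_closedBall
        (by linarith [pow_pos (one_half_pos (α := ℝ)) k])) h0
    have h2 : diniTerm μ s k v = ∞ := by
      rw [diniTerm, h1, ENNReal.div_zero (by simp; positivity)]
    exact hM (top_unique (h2.symm.le.trans ((ENNReal.le_tsum k).trans (hdini v (hEA hv)))))
  let a : ℕ → ℝ≥0∞ := fun j => C * (3 ^ n * ∫⁻ x in A, diniTerm μ s (m + j) x ∂μ)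
  have ha : ∑' j, a j ≠ ∞ := by
    have h1 : ∑' j, ∫⁻ x in A, diniTerm μ s (m + j) x ∂μ ≤ M * μ A := by
      rw [← lintegral_tsum fun j => (measurable_diniTerm _).aemeasurable, ← setLIntegral_const]
      refine setLIntegral_mono' hA fun x hx => le_trans ?_ (hdini x hx)
      exact ENNReal.tsum_comp_le_tsum_of_injective (add_right_injective m) _
    simp only [a, ENNReal.tsum_mul_left]
    have h2 := (h1.trans_lt (ENNReal.mul_lt_top hM.lt_top hAtop.lt_top)).ne
    exact ENNReal.mul_ne_top hC (ENNReal.mul_ne_top (by finiteness) h2)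
  have hcount := fun j => ENNReal.finite_and_mul_ncard_le
    (c := ENNReal.ofReal (((1 / 2 : ℝ) ^ (m + j)) ^ s)) (by simp; positivity)
    (ENNReal.ne_top_of_tsum_ne_top ha j)
    (mul_card_dyadicIndex_le (hpos (m + j)) (hdens (m + j) (by omega)))
  have hfin := fun j => (hcount j).1
  have hsum : Summable fun j =>
      ((1 / 2 : ℝ) ^ (m + j)) ^ s * (dyadicIndex (m + j) '' E).ncard := by
    refine Summable.of_nonneg_of_le (fun j => by positivity) (fun j => ?_)
      (ENNReal.summable_toReal ha)
    rw [← ENNReal.ofReal_le_iff_le_toReal (ENNReal.ne_top_of_tsum_ne_top ha j),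
      ENNReal.ofReal_mul (by positivity), ENNReal.ofReal_natCast]
    exact (hcount j).2
  refine ⟨Metric.isCompact_of_isClosed_isBounded isClosed_closure ?_,
    hausdorffMeasure_closure_eq_zero_of_summable_dyadic hs0 hfin hsum,
    exists_holderCurve_of_summable_dyadic hs hcube hfin hsum⟩
  exact (Metric.isBounded_iff.2 ⟨_, fun x hx y hy =>
    dist_le_of_dyadicIndex_eq (hcube x hx y hy)⟩).closure

theorem AsymptoticallyDoublingAt.exists_eventually_le {x : EuclideanSpace ℝ (Fin n)}
    (h : AsymptoticallyDoublingAt μ x) (hx : ∀ r > 0, μ (Metric.closedBall x r) ≠ 0) :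
    ∃ C : ℕ, ∀ᶠ r in 𝓝[>] (0 : ℝ),
      μ (Metric.closedBall x (2 * r)) ≤ C * μ (Metric.closedBall x r) := by
  obtain ⟨C, hC⟩ := ENNReal.exists_nat_gt (ne_of_lt h)
  refine ⟨C, ?_⟩
  filter_upwards [eventually_lt_of_limsup_lt hC, self_mem_nhdsWithin] with r hr hr0
  exact (ENNReal.div_le_iff (hx r hr0) measure_closedBall_lt_top.ne).1 hr.le

/-- The points with finite Dini integral at which `μ` is asymptotically doubling are, up to a
`μ`-null set, covered by countably many sets to which `closure_mem_of_dini_of_density` applies. The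
parameters are a bound `M` for the norm and the Dini sum, a doubling constant, and a generation
together with a cube of that generation. The Besicovitch density theorem is used in the set `A M`,
which does not involve the doubling condition and is therefore easily seen to be measurable. -/
theorem carriedBy_compact_null_subsets_of_holderCurves (hs : 1 ≤ s) :
    CarriedBy (μ.restrict {x | diniIntegral μ s x < ∞ ∧ AsymptoticallyDoublingAt μ x})
      {K | IsCompact K ∧ Measure.hausdorffMeasure s K = 0 ∧
        ∃ Γ ∈ holderCurves (EuclideanSpace ℝ (Fin n)) s, K ⊆ Γ} := by
  have hs0 : 0 < s := by linarith
  let A : ℕ → Set (EuclideanSpace ℝ (Fin n)) := fun M =>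
    Metric.closedBall 0 M ∩ {x | ∑' k, diniTerm μ s k x ≤ M}
  have hA : ∀ M, MeasurableSet (A M) := fun M => measurableSet_closedBall.inter
    (measurableSet_le (Measurable.tsum fun k => measurable_diniTerm k) measurable_const)
  let E : ℕ × ℕ × ℕ × (Fin n → ℤ) → Set (EuclideanSpace ℝ (Fin n)) := fun p =>
    {x | x ∈ A p.1 ∧ dyadicIndex p.2.2.1 x = p.2.2.2 ∧ ∀ k ≥ p.2.2.1,
      μ (Metric.closedBall x (2 * (1 / 2) ^ k)) ≤
        p.2.1 * 2 * μ (A p.1 ∩ Metric.closedBall x ((1 / 2) ^ k))}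
  have hE : ∀ p, closure (E p) ∈ {K | IsCompact K ∧ Measure.hausdorffMeasure s K = 0 ∧
        ∃ Γ ∈ holderCurves (EuclideanSpace ℝ (Fin n)) s, K ⊆ Γ} := fun p =>
    closure_mem_of_dini_of_density (m := p.2.2.1) (M := p.1) (C := p.2.1 * 2) hs (hA p.1)
      ((measure_mono inter_subset_left).trans_lt measure_closedBall_lt_top).ne
      (by finiteness) (by finiteness)
      (fun x hx => hx.2) (fun x hx => hx.1)
      (fun x hx y hy => hx.2.1.trans hy.2.1.symm) fun k hk v hv => hv.2.2 k hk
  obtain ⟨e, he⟩ := exists_surjective_nat (ℕ × ℕ × ℕ × (Fin n → ℤ))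
  refine ⟨fun i => closure (E (e i)), fun i => hE _, ?_⟩
  rw [Measure.restrict_apply (MeasurableSet.iUnion fun i => isClosed_closure.measurableSet).compl]
  have hdensity : ∀ᵐ x ∂μ, ∀ M, x ∈ A M → Tendsto
      (fun r => μ (A M ∩ Metric.closedBall x r) / μ (Metric.closedBall x r)) (𝓝[>] 0) (𝓝 1) :=
    ae_all_iff.2 fun M => (ae_restrict_iff' (hA M)).1 (Besicovitch.ae_tendsto_measure_inter_div μ _)
  refine measure_mono_null (fun x hx => ?_) hdensity
  simp only [mem_compl_iff, mem_ofPred_eq]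
  rintro hd
  obtain ⟨hxK, hxdini, hxdoubl⟩ := hx
  have hsum := tsum_diniTerm_ne_top hs0 hxdini
  obtain ⟨M, hMx, hMs⟩ : ∃ M : ℕ, ‖x‖ ≤ M ∧ ∑' k, diniTerm μ s k x ≤ M := by
    obtain ⟨M₁, h₁⟩ := exists_nat_ge ‖x‖
    obtain ⟨M₂, h₂⟩ := ENNReal.exists_nat_gt hsum
    refine ⟨max M₁ M₂, h₁.trans (by exact_mod_cast le_max_left _ _),
      h₂.le.trans (by exact_mod_cast le_max_right _ _)⟩
  have hxA : x ∈ A M := ⟨by simpa using hMx, hMs⟩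
  -- A null ball around `x` would make all the later terms of the Dini sum infinite.
  have hxpos : ∀ r > 0, μ (Metric.closedBall x r) ≠ 0 := by
    intro r hr h0
    obtain ⟨k, hk⟩ := exists_pow_lt_of_lt_one hr (one_half_lt_one (α := ℝ))
    refine ENNReal.ne_top_of_tsum_ne_top hsum k ?_
    rw [diniTerm, measure_mono_null (Metric.closedBall_subset_closedBall hk.le) h0,
      ENNReal.div_zero (by simp; positivity)]
  obtain ⟨C, hC⟩ := hxdoubl.exists_eventually_le hxpos
  have hhalf : ∀ᶠ r in 𝓝[>] (0 : ℝ),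
      μ (Metric.closedBall x r) ≤ 2 * μ (A M ∩ Metric.closedBall x r) := by
    filter_upwards [(hd M hxA).eventually_const_lt ENNReal.one_half_lt_one, self_mem_nhdsWithin]
      with r hr hr0
    -- `1 / 2` is any number below the limit density `1`; it accounts for the factor `2` in `E`.
    have h1 := (ENNReal.le_div_iff_mul_le (.inl (hxpos r hr0))
      (.inl measure_closedBall_lt_top.ne)).1 hr.le
    calc μ (Metric.closedBall x r) = 2 * (2⁻¹ * μ (Metric.closedBall x r)) := by
          rw [← mul_assoc, ENNReal.mul_inv_cancel (by simp) (by simp), one_mul]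
      _ ≤ _ := by gcongr
  have hlim : Tendsto (fun k : ℕ => (1 / 2 : ℝ) ^ k) atTop (𝓝[>] 0) :=
    tendsto_nhdsWithin_iff.2 ⟨tendsto_pow_atTop_nhds_zero_of_lt_one (by norm_num) (by norm_num),
      .of_forall fun k => by simp⟩
  obtain ⟨m, hm⟩ := eventually_atTop.1 (hlim.eventually (hC.and hhalf))
  obtain ⟨i, hi⟩ := he (M, C, m, dyadicIndex m x)
  refine hxK (mem_iUnion.2 ⟨i, subset_closure ?_⟩)
  rw [hi]
  refine ⟨hxA, rfl, fun k hk => ?_⟩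
  rw [mul_assoc]
  exact (hm k hk).1.trans (mul_le_mul_right (hm k hk).2 _)

end

theorem theoremA (n : ℕ) (μ : Measure (EuclideanSpace ℝ (Fin n))) [IsLocallyFiniteMeasure μ]
    (s : ℝ) (hs : 1 ≤ s) (hsn : s < n) :
    SingularTo (μ.restrict {x | lowerDensity μ s x = 0})
      (holderCurves (EuclideanSpace ℝ (Fin n)) s) ∧
    CarriedBy (μ.restrict {x | diniIntegral μ s x < ∞ ∧ AsymptoticallyDoublingAt μ x})
      (holderCurves (EuclideanSpace ℝ (Fin n)) s) ∧
    CarriedBy (μ.restrict {x | diniIntegral μ s x < ∞ ∧ AsymptoticallyDoublingAt μ x})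
      {K | IsCompact K ∧ Measure.hausdorffMeasure s K = 0 ∧
        ∃ Γ ∈ holderCurves (EuclideanSpace ℝ (Fin n)) s, K ⊆ Γ} := by
  -- The compact sets of the last claim lie in Hölder curves, which gives the second one.
  have h := carriedBy_compact_null_subsets_of_holderCurves (μ := μ) hs
  refine ⟨singularTo_holderCurves μ hs, ?_, h⟩
  obtain ⟨K, hK, hμ⟩ := h
  choose Γ hΓ hKΓ using fun i => (hK i).2.2
  exact ⟨Γ, hΓ, measure_mono_null (compl_subset_compl.2 (iUnion_mono hKΓ)) hμ⟩
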